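/- **Setting.** In Spekkens' toy model an elementary system has four ontic states, written $(x,z)\in\{0,1\}^2$; the toy observables $\mathcal X,\mathcal Z,\mathcal Y=\mathcal X\mathcal Z$ take the values $(-1)^x,(-1)^z,(-1)^{x+z}$; an observable $g$ has the state $\rho_g=\frac14(\mathcal I+g)$ (a probability distribution on ontic states) and the projector $P_g=\frac12(\mathcal I+g)$. Transformations are permutations of the ontic states: the Hadamard $\tilde{\mathcal H}$ exchanges $x$ and $z$, the controlled-$\tilde{\mathcal Z}$ on systems $i,j$ adds $z_j$ to $x_i$ and $z_i$ to $x_j$, and for a setting $\delta=(\delta_1,\delta_2)\in\{0,1\}^2$ (sign bit, basis bit) the rotation $\tilde{\mathcal R}(\delta)$ maps $(x,z)$ to $(x+\delta_2z+\delta_1,z)$ (all sums of bits are mod 2). **Protocol.** Let $G$ be a finite graph whose $n\ge1$ vertices are the systems, in a fixed linear order of measurement. Alice picks a trap position $t$ uniformly at random; the neighbours of $t$ are dummies, and the remaining vertices other than $t$ form the set $K_t$ of computational systems. For every $t$ there is fixed a measurement-based toy computation on $K_t$: inputs $I_t$ and outputs $O_t\subseteq K_t$, angles $\varphi_i\in\{0,1\}^2$,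 and a gflow $g$ assigning to each $i\in K_t\setminus O_t$ a set $g(i)\subseteq K_t\setminus I_t$ such that $j\in g(i),\ j\ne i$ implies $i<j$; $j\in K_t$, $j<i$ implies $j\notin\mathrm{Odd}(g(i))$; and $i\notin g(i)$, $i\in \mathrm{Odd}(g(i))$. Alice also picks, uniformly and independently for each system, pads $\theta_i\in\{0,1\}^2$, $r_i\in\{0,1\}$, $d_i\in\{0,1\}$. She prepares each dummy in $\rho_{(-1)^{d_i}\mathcal Z}$, and every other system in $\rho_{(-1)^{\theta_{i,1}}\mathcal X}$ if $\theta_{i,2}=0$ and in $\rho_{(-1)^{\theta_{i,1}}\mathcal Y}$ if $\theta_{i,2}=1$. Let $b$ be the outcomes reported for the systems outside $O_t\cup\{t\}$. The decoded outcome of $j$ is $s_j=b_j+r_j+D_j$, where $D_j$ is the sum of $d_k$ over the dummies $k$ adjacent to $j$. The correction of $i$ is $c_i=\sum_{j\neq i,\ i\in \mathrm{Odd}(g(j))}s_j+\varphi_{i,2}\sum_{j:\ i\in g(j)}s_j$. The settings are $\delta_i=(\varphi'_{i,1}+\theta_{i,1}+r_i,\ \varphi'_{i,2}+\theta_{i,2})$,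 where $\varphi'_i=(\varphi_{i,1}+c_i,\varphi_{i,2})$ on $K_t\setminus O_t$, $\varphi'_i=\varphi_i$ on $O_t$, and $\varphi'_i=0$ on the trap and the dummies. They are stored in a register $\Delta$ of toy systems in $\mathcal Z$-eigenstates. The honest permutation is $\tilde{\mathcal U}^{hon}=\bigotimes_i\tilde{\mathcal H}_i\tilde{\mathcal R}_i(\delta_i)\,\tilde{\mathcal E}_G$, with $\tilde{\mathcal E}_G$ the product of the controlled-$\tilde{\mathcal Z}$ permutations over the edges of $G$. It is followed by Bob's deviation: an arbitrary permutation $\tilde\Omega$ of the ontic states of all $n$ systems, of $\Delta$, and of a finite set $B$ of private toy systems of Bob in an arbitrary initial state $\xi_B$. For each branch $b$ the resulting state is projected on the $\mathcal Z$-outcomes $b$ of the systems outside $O_t\cup\{t\}$, each output $i$ is corrected by $\tilde{\mathcal X}^{\,r_i+D_i+c_i}$ (a flip of $z_i$ if the exponent is $1$), and everything except $O_t\cup\{t\}$ is traced out; the sum over $b$ is $\rho^{out}_{O_t,t}$. Let $P^{honest}_{O_t}$ be the projector on the classical ($\mathcal Z$) outputs which have non-zero probability when $\tilde\Omega$ is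 the identity (for the same $t$ and pads), and let $P_t^{r_t}$ be the projector on the correct trap outcome, $z_t=r_t+D_t$. The probability of failure (accepting a wrong output) is $$p_{fail}=\sum_{t,\theta,r,d}p(t,\theta,r,d)\,\mathrm{Tr}\Big[\big((I-P^{honest}_{O_t})\otimes P_t^{r_t}\big)\rho^{out}_{O_t,t}\Big],$$ where $p$ is the uniform distribution. **Theorem.** For every such protocol with $n$ systems, every $B$, every $\xi_B$ and every deviation $\tilde\Omega$ of Bob, $$p_{fail}\le 1-\frac1{2n}.$$ -/

import Mathlib

namespace ToyFK

/-! ## Elementary toy systems -/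

/-- Bits; addition is exclusive or. -/
abbrev Bit := ZMod 2

/-- The four ontic states of an elementary toy system, written as `(x, z)`:
`e₁ = (0,0)`, `e₂ = (1,0)`, `e₃ = (0,1)`, `e₄ = (1,1)`. -/
abbrev Ontic := Bit × Bit

/-- `(-1)^a`. -/
def sgn (a : Bit) : ℝ := if a = 0 then 1 else -1

/-- The toy observable `X = diag(1,-1,1,-1)`. Diagonal matrices, in particular toy observables,
projectors and the ontic distributions `ρ`, are written as real functions on ontic states. -/
def obsX : Ontic → ℝ := fun o => sgn o.1

/-- The toy observable `Z = diag(1,1,-1,-1)`. -/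
def obsZ : Ontic → ℝ := fun o => sgn o.2

/-- The toy observable `Y = X Z = diag(1,-1,-1,1)`. -/
def obsY : Ontic → ℝ := fun o => obsX o * obsZ o

/-- The ontic distribution `ρ_g = (I + g)/4` of the single-system state stabilised by `g`. -/
noncomputable def rho (g : Ontic → ℝ) : Ontic → ℝ := fun o => (1 + g o) / 4

/-- The projector `P_g = (I + g)/2`. -/
noncomputable def proj (g : Ontic → ℝ) : Ontic → ℝ := fun o => (1 + g o) / 2

/-- The state `ρ_{±Z}` with `Z`-value `a`. -/
noncomputable def rhoZ (a : Bit) : Ontic → ℝ := rho (fun o => sgn a * obsZ o)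

/-- The projector on the `Z`-value `a`. -/
noncomputable def projZ (a : Bit) : Ontic → ℝ := proj (fun o => sgn a * obsZ o)

/-- Labels of states and of measurement settings in the `X`-`Y` plane: the first bit is the sign,
the second bit is the basis (`0` for `X`, `1` for `Y`). -/
abbrev Angle := Bit × Bit

/-- The one-time padded state `ρ_θ`, one of `ρ_X`, `ρ_{-X}`, `ρ_Y`, `ρ_{-Y}`. -/
noncomputable def rhoAngle (θ : Angle) : Ontic → ℝ :=
  rho (fun o => sgn θ.1 * (if θ.2 = 0 then obsX o else obsY o))

/-- The toy Hadamard `(1)(23)(4)`; it exchanges `X` and `Z`. -/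
def hadamard : Ontic ≃ Ontic := Equiv.prodComm Bit Bit

/-- The rotation `R(δ)`: it fixes `Z` and takes the observable `X`, `-X`, `Y`, `-Y` with label `δ`
to `X`, so that `R(δ)` and the Hadamard followed by a `Z` measurement measure the setting `δ`. -/
def rotate (δ : Angle) : Ontic ≃ Ontic where
  toFun o := (o.1 + δ.2 * o.2 + δ.1, o.2)
  invFun o := (o.1 + δ.2 * o.2 + δ.1, o.2)
  left_inv := by
    rintro ⟨x, z⟩
    rcases δ with ⟨s, c⟩
    revert x z s c
    decide
  right_inv := by
    rintro ⟨x, z⟩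
    rcases δ with ⟨s, c⟩
    revert x z s c
    decide

/-- The transformed distribution `U ρ Uᵀ` for a permutation `U` of the ontic states. -/
def act {α : Type*} (U : α ≃ α) (ρ : α → ℝ) : α → ℝ := fun a => ρ (U.symm a)

section Protocol

variable {V : Type*} [Fintype V] [LinearOrder V]

/-! ## The graph, the trap, the dummies and the computation -/

/-- The product `E_G` of the controlled-`Z` permutations over all edges of `G`. A controlled-`Z` on
systems `i`, `j` adds `z_j` to `x_i` and `z_i` to `x_j`. -/
def entangle (G : SimpleGraph V) [DecidableRel G.Adj] : (V → Ontic) ≃ (V → Ontic) where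
  toFun l i := ((l i).1 + ∑ j ∈ G.neighborFinset i, (l j).2, (l i).2)
  invFun l i := ((l i).1 + ∑ j ∈ G.neighborFinset i, (l j).2, (l i).2)
  left_inv := by
    intro l
    funext i
    simp [add_assoc, CharTwo.add_self_eq_zero]
  right_inv := by
    intro l
    funext i
    simp [add_assoc, CharTwo.add_self_eq_zero]

/-- The computational systems when the trap is at `t`: neither the trap nor one of the dummies,
which are the neighbours of the trap. -/
def comp (G : SimpleGraph V) [DecidableRel G.Adj] (t : V) : Finset V :=
  Finset.univ.filter fun i => i ≠ t ∧ ¬ G.Adj t i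

/-- `j` is in the odd neighbourhood of `K`. -/
def InOdd (G : SimpleGraph V) [DecidableRel G.Adj] (K : Finset V) (j : V) : Prop :=
  Odd (G.neighborFinset j ∩ K).card

instance (G : SimpleGraph V) [DecidableRel G.Adj] (K : Finset V) (j : V) :
    Decidable (InOdd G K j) :=
  inferInstanceAs (Decidable (Odd _))

/-- A measurement-based toy computation on the computational systems that are left when the trap is
at `t`: inputs, outputs, measurement angles, and a gflow for the order in which the systems are
measured (the linear order of `V`). -/
structure Pattern (G : SimpleGraph V) [DecidableRel G.Adj] (t : V) where
  inputs : Finset V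
  outputs : Finset V
  angle : V → Angle
  gflow : V → Finset V
  inputs_subset : inputs ⊆ comp G t
  outputs_subset : outputs ⊆ comp G t
  gflow_subset : ∀ i ∈ comp G t \ outputs, gflow i ⊆ comp G t \ inputs
  gflow_later : ∀ i ∈ comp G t \ outputs, ∀ j ∈ gflow i, i ≠ j → i < j
  gflow_past : ∀ i ∈ comp G t \ outputs, ∀ j ∈ comp G t, j < i → ¬ InOdd G (gflow i) j
  gflow_self : ∀ i ∈ comp G t \ outputs, i ∉ gflow i ∧ InOdd G (gflow i) i

/-- The random pads `(θ, r, d)`: a state pad `θ_i`, an outcome pad `r_i` and a dummy bit `d_i` for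
every system. The pad `θ_i` of a dummy only hides its measurement setting, and `d_i` is only used
for dummies. -/
abbrev Pads (V : Type*) := (V → Angle) × (V → Bit) × (V → Bit)

/-- The systems which are neither outputs nor the trap; their outcomes are the branch `b`. -/
def measured {G : SimpleGraph V} [DecidableRel G.Adj] {t : V} (C : Pattern G t) : Finset V :=
  Finset.univ \ insert t C.outputs

/-- A branch: the outcomes reported for all systems other than the outputs and the trap. -/
abbrev Branch {G : SimpleGraph V} [DecidableRel G.Adj] {t : V} (C : Pattern G t) :=
  {i // i ∈ measured C} → Bit

/-- The bit of the extra Pauli `Z` which the dummies next to `i` put on system `i`. -/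
def dummyShift (G : SimpleGraph V) [DecidableRel G.Adj] (t : V) (ν : Pads V) (i : V) : Bit :=
  ∑ j ∈ G.neighborFinset i ∩ G.neighborFinset t, ν.2.2 j

/-- The decoded outcome of system `j` in branch `b`. -/
def decoded {G : SimpleGraph V} [DecidableRel G.Adj] {t : V} (C : Pattern G t) (ν : Pads V)
    (b : Branch C) (j : V) : Bit :=
  (if h : j ∈ measured C then b ⟨j, h⟩ else 0) + ν.2.1 j + dummyShift G t ν j

/-- The bit of the gflow correction for the sign of the angle of `i`: the decoded outcomes of the
systems that put a Pauli `Z` on `i`, which flips `X` and `Y`, and of those that put a Pauli `X` on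
`i`, which flips `Y` only. -/
def correction {G : SimpleGraph V} [DecidableRel G.Adj] {t : V} (C : Pattern G t) (ν : Pads V)
    (b : Branch C) (i : V) : Bit :=
  (∑ j ∈ (comp G t \ C.outputs).filter (fun j => j ≠ i ∧ InOdd G (C.gflow j) i),
      decoded C ν b j) +
    (C.angle i).2 *
      ∑ j ∈ (comp G t \ C.outputs).filter (fun j => i ∈ C.gflow j), decoded C ν b j

/-- The angle `φ_i` before padding: gflow-corrected for the computational systems that are not
outputs, uncorrected for the outputs (which are corrected at the end), zero for trap and dummies. -/
def phi {G : SimpleGraph V} [DecidableRel G.Adj] {t : V} (C : Pattern G t) (ν : Pads V)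
    (b : Branch C) (i : V) : Angle :=
  if i ∈ C.outputs then C.angle i
  else if i ∈ comp G t then ((C.angle i).1 + correction C ν b i, (C.angle i).2)
  else (0, 0)

/-- The setting `δ_i` sent to Bob: signs add up with `r_i`, bases add up. -/
def delta {G : SimpleGraph V} [DecidableRel G.Adj] {t : V} (C : Pattern G t) (ν : Pads V)
    (b : Branch C) (i : V) : Angle :=
  ((phi C ν b i).1 + (ν.1 i).1 + ν.2.1 i, (phi C ν b i).2 + (ν.1 i).2)

/-! ## The states of the protocol -/

/-- The state of the systems `N` prepared by Alice: dummies in `ρ_{±Z}`, the others in `ρ_θ`. -/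
noncomputable def prepared (G : SimpleGraph V) [DecidableRel G.Adj] (t : V) (ν : Pads V) :
    (V → Ontic) → ℝ :=
  fun l => ∏ i, if G.Adj t i then rhoZ (ν.2.2 i) (l i) else rhoAngle (ν.1 i) (l i)

/-- The state of the instruction register `Δ`: two systems in `ρ_{±Z}` for each setting. -/
noncomputable def instruction (δ : V → Angle) : (V → Ontic × Ontic) → ℝ :=
  fun m => ∏ i, rhoZ (δ i).1 (m i).1 * rhoZ (δ i).2 (m i).2

/-- The honest permutation on `N` and `Δ`: first the entangling permutation, then on every system
the rotation controlled by its instruction and the Hadamard. -/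
def honest (G : SimpleGraph V) [DecidableRel G.Adj] :
    (V → Ontic) × (V → Ontic × Ontic) ≃ (V → Ontic) × (V → Ontic × Ontic) where
  toFun p := (fun i => hadamard (rotate ((p.2 i).1.2, (p.2 i).2.2) (entangle G p.1 i)), p.2)
  invFun p := ((entangle G).symm
    (fun i => (rotate ((p.2 i).1.2, (p.2 i).2.2)).symm (hadamard.symm (p.1 i))), p.2)
  left_inv := by
    rintro ⟨l, m⟩
    simp
  right_inv := by
    rintro ⟨l, m⟩
    simp

/-- Ontic states of all systems: `N`, the instructions `Δ`, and Bob's private systems `B`. -/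
abbrev All (V B : Type*) := (V → Ontic) × (V → Ontic × Ontic) × (B → Ontic)

variable {B : Type*} [Fintype B] [DecidableEq B]

/-- The state `σ_All` in branch `b`: honest permutation, then Bob's deviation `Ω`. -/
noncomputable def sigmaAll {G : SimpleGraph V} [DecidableRel G.Adj] {t : V} (C : Pattern G t)
    (ν : Pads V) (ξ : (B → Ontic) → ℝ) (Ω : All V B ≃ All V B) (b : Branch C) :
    All V B → ℝ :=
  act Ω fun ω =>
    act (honest G) (fun p => prepared G t ν p.1 * instruction (delta C ν b) p.2) (ω.1, ω.2.1) *
      ξ ω.2.2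

/-- The projector on the outcomes `b` for all systems other than the outputs and the trap. -/
noncomputable def projBranch {G : SimpleGraph V} [DecidableRel G.Adj] {t : V} (C : Pattern G t)
    (b : Branch C) : All V B → ℝ :=
  fun ω => ∏ i : {i // i ∈ measured C}, projZ (b i) (ω.1 i)

/-- The bit which decodes output `i`: outcome pad, neighbouring dummies and gflow correction. -/
def outputFlip {G : SimpleGraph V} [DecidableRel G.Adj] {t : V} (C : Pattern G t) (ν : Pads V)
    (b : Branch C) (i : V) : Bit :=
  if i ∈ C.outputs then ν.2.1 i + dummyShift G t ν i + correction C ν b i else 0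

/-- The correction permutation on the outputs: a toy Pauli `X` where `outputFlip` is one. -/
def correct {G : SimpleGraph V} [DecidableRel G.Adj] {t : V} (C : Pattern G t) (ν : Pads V)
    (b : Branch C) : All V B ≃ All V B where
  toFun ω := (fun i => ((ω.1 i).1, (ω.1 i).2 + outputFlip C ν b i), ω.2)
  invFun ω := (fun i => ((ω.1 i).1, (ω.1 i).2 + outputFlip C ν b i), ω.2)
  left_inv := by
    rintro ⟨l, m⟩
    simp [add_assoc, CharTwo.add_self_eq_zero]
  right_inv := by
    rintro ⟨l, m⟩
    simp [add_assoc, CharTwo.add_self_eq_zero]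

/-- Partial trace over everything except the systems in `S ⊆ N`. -/
noncomputable def traceTo (S : Finset V) (σ : All V B → ℝ) : ({i // i ∈ S} → Ontic) → ℝ :=
  fun κ => ∑ ω, if (fun i : {i // i ∈ S} => ω.1 i) = κ then σ ω else 0

/-- Ontic states of the outputs together with the trap. -/
abbrev Final {G : SimpleGraph V} [DecidableRel G.Adj] {t : V} (C : Pattern G t) :=
  {i // i ∈ insert t C.outputs} → Ontic

/-- The output state `ρ^out` on the outputs and the trap, summed over all branches. -/
noncomputable def rhoOut {G : SimpleGraph V} [DecidableRel G.Adj] {t : V} (C : Pattern G t)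
    (ν : Pads V) (ξ : (B → Ontic) → ℝ) (Ω : All V B ≃ All V B) : Final C → ℝ :=
  fun κ => ∑ b : Branch C, traceTo (insert t C.outputs)
    (act (correct C ν b) (fun ω => projBranch C b ω * sigmaAll C ν ξ Ω b ω)) κ

/-- The output state of the honest run, which has no deviation. -/
noncomputable def rhoHonest {G : SimpleGraph V} [DecidableRel G.Adj] {t : V} (C : Pattern G t)
    (ν : Pads V) (ξ : (B → Ontic) → ℝ) : Final C → ℝ :=
  rhoOut C ν ξ (Equiv.refl _)

/-! ## The figure of merit -/

/-- The projector on the `Z` outcomes `a` of the outputs. -/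
noncomputable def projOutputs {G : SimpleGraph V} [DecidableRel G.Adj] {t : V} (C : Pattern G t)
    (a : {i // i ∈ C.outputs} → Bit) : Final C → ℝ :=
  fun κ => ∏ i : {i // i ∈ C.outputs}, projZ (a i) (κ ⟨i, Finset.mem_insert_of_mem i.2⟩)

open Classical in
/-- The projector `P^honest` on the honest classical output: the sum of the projectors on all
outcomes which the honest run can give. If the honest output is a single bit string, then it is
the projector on that string. -/
noncomputable def projHonest {G : SimpleGraph V} [DecidableRel G.Adj] {t : V} (C : Pattern G t)
    (ν : Pads V) (ξ : (B → Ontic) → ℝ) : Final C → ℝ :=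
  fun κ => ∑ a : {i // i ∈ C.outputs} → Bit,
    if ∑ κ₀, projOutputs C a κ₀ * rhoHonest C ν ξ κ₀ ≠ 0 then projOutputs C a κ else 0

/-- The projector on the correct trap state: `Z`-value `r_t`, up to the known dummy shift. -/
noncomputable def projTrap {G : SimpleGraph V} [DecidableRel G.Adj] {t : V} (C : Pattern G t)
    (ν : Pads V) : Final C → ℝ :=
  fun κ => projZ (ν.2.1 t + dummyShift G t ν t) (κ ⟨t, Finset.mem_insert_self t _⟩)

/-- The probability of failure: the trap is found in its correct state and the output is not
honest, averaged over the uniform trap position and the uniform pads. -/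
noncomputable def pFail (G : SimpleGraph V) [DecidableRel G.Adj] (C : ∀ t, Pattern G t)
    (ξ : (B → Ontic) → ℝ) (Ω : All V B ≃ All V B) : ℝ :=
  ∑ t : V, ∑ ν : Pads V, 1 / (Fintype.card V * Fintype.card (Pads V) : ℝ) *
    ∑ κ, (1 - projHonest (C t) ν ξ κ) * projTrap (C t) ν κ * rhoOut (C t) ν ξ Ω κ

end Protocol

end ToyFK

namespace ToyFK

/-! ## Supports of the elementary distributions -/

/-! Everything is classical: Bob permutes ontic states, and both the acceptance test and the output
are read from `Z`-values. Before the deviation the trap has its correct value, and a run whose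
`Z`-values are left alone gives an honest output. Hence failure at `ω` requires that `Ω` keep the
`Z`-value of the trap and flip some other one (`fail_le`). For a fixed `ω` at most `n - 1` trap
positions allow this (`card_undetected_le`).

This count bounds the probability only if `ω` carries no information about the trap. That is
blindness, `sum_honestState_le`: for every trap position and branch, the sum over the `16 ^ n` pads
is at most `4⁻ⁿ`, so the average is at most `64⁻ⁿ`, the uniform weight on `N` and `Δ`. It holds
because `ω` and the branch determine all pads except `n` idle bits. The settings are adaptive, but
the gflow lets corrections use earlier outcomes only, so the pads are recovered in measurement
order.

Averaging the count over `n` trap positions gives `1 - 1 / n`, stronger than the stated bound.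
Determinism of the computation plays no role. -/

lemma bit_eq_zero_or_one : ∀ a : Bit, a = 0 ∨ a = 1 := by decide

lemma rhoZ_eq (a : Bit) (o : Ontic) : rhoZ a o = if o.2 = a then 1 / 2 else 0 := by
  obtain ⟨x, z⟩ := o
  obtain rfl | rfl := bit_eq_zero_or_one a <;> obtain rfl | rfl := bit_eq_zero_or_one z <;>
    simp [rhoZ, rho, obsZ, sgn] <;> norm_num

lemma projZ_eq (a : Bit) (o : Ontic) : projZ a o = if o.2 = a then 1 else 0 := by
  obtain ⟨x, z⟩ := o
  obtain rfl | rfl := bit_eq_zero_or_one a <;> obtain rfl | rfl := bit_eq_zero_or_one z <;>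
    simp [projZ, proj, obsZ, sgn]

lemma rhoAngle_eq (θ : Angle) (o : Ontic) :
    rhoAngle θ o = if o.1 + θ.2 * o.2 = θ.1 then 1 / 2 else 0 := by
  obtain ⟨x, z⟩ := o
  obtain ⟨s, c⟩ := θ
  obtain rfl | rfl := bit_eq_zero_or_one s <;> obtain rfl | rfl := bit_eq_zero_or_one c <;>
    obtain rfl | rfl := bit_eq_zero_or_one x <;> obtain rfl | rfl := bit_eq_zero_or_one z <;>
    simp [rhoAngle, rho, obsX, obsY, obsZ, sgn, CharTwo.add_self_eq_zero] <;> norm_num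

section Protocol

variable {V : Type*} [Fintype V]

lemma prepared_nonneg (G : SimpleGraph V) [DecidableRel G.Adj] (t : V) (ν : Pads V)
    (l : V → Ontic) : 0 ≤ prepared G t ν l := by
  refine Finset.prod_nonneg fun i _ => ?_
  rw [rhoZ_eq, rhoAngle_eq]
  split_ifs <;> norm_num

lemma prepared_le (G : SimpleGraph V) [DecidableRel G.Adj] (t : V) (ν : Pads V)
    (l : V → Ontic) : prepared G t ν l ≤ (1 / 2) ^ Fintype.card V := by
  rw [← Finset.card_univ, ← Finset.prod_const]
  refine Finset.prod_le_prod (fun i _ => ?_) fun i _ => ?_ <;>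
  · rw [rhoZ_eq, rhoAngle_eq]
    split_ifs <;> norm_num

lemma instruction_nonneg (δ : V → Angle) (m : V → Ontic × Ontic) : 0 ≤ instruction δ m := by
  refine Finset.prod_nonneg fun i _ => ?_
  rw [rhoZ_eq, rhoZ_eq]
  split_ifs <;> norm_num

lemma instruction_le (δ : V → Angle) (m : V → Ontic × Ontic) :
    instruction δ m ≤ (1 / 4) ^ Fintype.card V := by
  rw [← Finset.card_univ, ← Finset.prod_const]
  refine Finset.prod_le_prod (fun i _ => ?_) fun i _ => ?_ <;>
  · rw [rhoZ_eq, rhoZ_eq]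
    split_ifs <;> norm_num

lemma eq_of_prepared_ne_zero {G : SimpleGraph V} [DecidableRel G.Adj] {t : V} {ν : Pads V}
    {l : V → Ontic} (h : prepared G t ν l ≠ 0) (i : V) :
    (G.Adj t i → (l i).2 = ν.2.2 i) ∧
      (¬ G.Adj t i → (l i).1 + (ν.1 i).2 * (l i).2 = (ν.1 i).1) := by
  have := Finset.prod_ne_zero_iff.1 h i (Finset.mem_univ i)
  simp only [rhoZ_eq, rhoAngle_eq] at this
  split_ifs at this <;> simp_all

lemma eq_of_instruction_ne_zero {δ : V → Angle} {m : V → Ontic × Ontic}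
    (h : instruction δ m ≠ 0) (i : V) : (m i).1.2 = (δ i).1 ∧ (m i).2.2 = (δ i).2 := by
  have := Finset.prod_ne_zero_iff.1 h i (Finset.mem_univ i)
  simp only [rhoZ_eq] at this
  split_ifs at this <;> simp_all

/-! ## Undetected deviations -/

variable {B : Type*}

/-- The deviation flips the `Z`-value of some system, but not that of the trap. -/
def Undetected (Ω : All V B ≃ All V B) (ω : All V B) (t : V) : Prop :=
  ((Ω ω).1 t).2 = (ω.1 t).2 ∧ ∃ i, ((Ω ω).1 i).2 ≠ (ω.1 i).2

instance (Ω : All V B ≃ All V B) (ω : All V B) : DecidablePred (Undetected Ω ω) :=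
  fun _ => inferInstanceAs (Decidable (_ ∧ _))

/-- A flipped system would itself detect the deviation if it were the trap; if nothing is flipped,
no position counts as undetected. -/
lemma card_undetected_le (Ω : All V B ≃ All V B) (ω : All V B) [Nonempty V] :
    ((Finset.univ.filter (Undetected Ω ω)).card : ℝ) ≤ Fintype.card V - 1 := by
  have : (Finset.univ.filter (Undetected Ω ω)).card < Fintype.card V := by
    rw [← Finset.card_univ]
    refine Finset.card_lt_card (Finset.filter_ssubset.2 ?_)
    by_cases h : ∃ i, ((Ω ω).1 i).2 ≠ (ω.1 i).2
    · obtain ⟨i, hi⟩ := h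
      exact ⟨i, Finset.mem_univ i, fun hu => hi hu.1⟩
    · exact ⟨Classical.arbitrary V, Finset.mem_univ _, fun hu => h hu.2⟩
  have : ((Finset.univ.filter (Undetected Ω ω)).card : ℝ) + 1 ≤ Fintype.card V := by
    exact_mod_cast this
  linarith

/-! ## The state before the deviation -/

variable [LinearOrder V] {G : SimpleGraph V} [DecidableRel G.Adj] {t : V}

/-- The state of `N` and `Δ` after the honest permutation, in branch `b`. -/
noncomputable def honestState (C : Pattern G t) (ν : Pads V) (b : Branch C) :
    (V → Ontic) × (V → Ontic × Ontic) → ℝ :=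
  act (honest G) fun p => prepared G t ν p.1 * instruction (delta C ν b) p.2

lemma honestState_nonneg (C : Pattern G t) (ν : Pads V) (b : Branch C)
    (p : (V → Ontic) × (V → Ontic × Ontic)) : 0 ≤ honestState C ν b p :=
  mul_nonneg (prepared_nonneg _ _ _ _) (instruction_nonneg _ _)

lemma honestState_le (C : Pattern G t) (ν : Pads V) (b : Branch C)
    (p : (V → Ontic) × (V → Ontic × Ontic)) : honestState C ν b p ≤ (1 / 8) ^ Fintype.card V := by
  calc honestState C ν b p ≤ (1 / 2) ^ Fintype.card V * (1 / 4) ^ Fintype.card V :=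
        mul_le_mul (prepared_le _ _ _ _) (instruction_le _ _) (instruction_nonneg _ _)
          (by positivity)
    _ = _ := by rw [← mul_pow]; norm_num

/-- On the support of the state before the deviation, the instructions are the settings, a dummy
carries its bit, and the `Z`-value of any other system is its padded measurement outcome. -/
lemma eq_of_honestState_ne_zero {C : Pattern G t} {ν : Pads V} {b : Branch C}
    {p : (V → Ontic) × (V → Ontic × Ontic)} (h : honestState C ν b p ≠ 0) (i : V) :
    ((p.2 i).1.2 = (delta C ν b i).1 ∧ (p.2 i).2.2 = (delta C ν b i).2) ∧
      (G.Adj t i → (p.1 i).1 = ν.2.2 i) ∧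
      (¬ G.Adj t i → (p.1 i).2 = (phi C ν b i).1 + (phi C ν b i).2 * (p.1 i).1 + ν.2.1 i +
        ∑ j ∈ G.neighborFinset i, (p.1 j).1) := by
  obtain ⟨h1, h2⟩ := mul_ne_zero_iff.1 h
  have hm : (p.2 i).1.2 = (delta C ν b i).1 ∧ (p.2 i).2.2 = (delta C ν b i).2 :=
    eq_of_instruction_ne_zero h2 i
  refine ⟨hm, (eq_of_prepared_ne_zero h1 i).1, fun hi => ?_⟩
  have := (eq_of_prepared_ne_zero h1 i).2 hi
  -- This undoes the honest permutation. The Hadamard exchanges `x` and `z`, so `(p.1 i).1` is the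
  -- `Z`-value of `i` before it; the rotation and the entangling permutation are their own inverses.
  change (p.1 i).2 + (p.2 i).2.2 * (p.1 i).1 + (p.2 i).1.2 + ∑ j ∈ G.neighborFinset i, (p.1 j).1 +
    (ν.1 i).2 * (p.1 i).1 = (ν.1 i).1 at this
  rw [hm.1, hm.2] at this
  simp only [delta] at this
  have h2 : (2 : Bit) = 0 := rfl
  -- The state pad `θ` occurs in both the setting and the preparation, so it cancels mod 2; the
  -- multiple of `2 = 0` absorbs the doubled terms and signs.
  linear_combination this -
    ((ν.1 i).2 * (p.1 i).1 + ∑ j ∈ G.neighborFinset i, (p.1 j).1 + (ν.2.1 i) +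
      (phi C ν b i).1 + (phi C ν b i).2 * (p.1 i).1) * h2

lemma notMem_outputs (C : Pattern G t) : t ∉ C.outputs := fun h =>
  (Finset.mem_filter.1 (C.outputs_subset h)).2.1 rfl

/-! ### Recovering the pads from an ontic state -/

lemma decoded_congr {C : Pattern G t} {ν ν' : Pads V} (b : Branch C) {j : V}
    (hd : ν.2.2 = ν'.2.2) (hr : ν.2.1 j = ν'.2.1 j) : decoded C ν b j = decoded C ν' b j := by
  simp only [decoded, dummyShift, hd, hr]

/-- The correction of `i` only depends on the pads of the systems measured before `i`. -/
lemma correction_congr {C : Pattern G t} {ν ν' : Pads V} (b : Branch C) {i : V}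
    (hi : i ∈ comp G t) (hd : ν.2.2 = ν'.2.2) (hr : ∀ j < i, j ∈ comp G t → ν.2.1 j = ν'.2.1 j) :
    correction C ν b i = correction C ν' b i := by
  unfold correction
  congr 1
  · refine Finset.sum_congr rfl fun j hj => ?_
    obtain ⟨hj, hne, hodd⟩ := Finset.mem_filter.1 hj
    refine decoded_congr b hd (hr j ?_ (Finset.mem_sdiff.1 hj).1)
    by_contra hlt
    exact C.gflow_past j hj i hi (lt_of_le_of_ne (not_lt.1 hlt) hne.symm) hodd
  · congr 1
    refine Finset.sum_congr rfl fun j hj => ?_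
    obtain ⟨hj, hmem⟩ := Finset.mem_filter.1 hj
    refine decoded_congr b hd (hr j ?_ (Finset.mem_sdiff.1 hj).1)
    refine C.gflow_later j hj i hmem fun e => (C.gflow_self j hj).1 ?_
    rwa [← e] at hmem

lemma phi_congr {C : Pattern G t} {ν ν' : Pads V} (b : Branch C) {i : V}
    (hd : ν.2.2 = ν'.2.2) (hr : ∀ j < i, j ∈ comp G t → ν.2.1 j = ν'.2.1 j) :
    phi C ν b i = phi C ν' b i := by
  unfold phi
  split_ifs with _ hi
  · rfl
  · rw [correction_congr b hi hd hr]
  · rfl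

/-- The pad bits which leave no trace in the state before the deviation: the outcome pads of the
dummies and the dummy bits of the other systems. -/
def idlePads (G : SimpleGraph V) [DecidableRel G.Adj] (t : V) (ν : Pads V) : V → Bit :=
  fun i => if G.Adj t i then ν.2.1 i else ν.2.2 i

/-- In a fixed branch, an ontic state determines the pads up to the idle ones. -/
lemma idlePads_injOn (C : Pattern G t) (b : Branch C) (p : (V → Ontic) × (V → Ontic × Ontic)) :
    Set.InjOn (idlePads G t) {ν | honestState C ν b p ≠ 0} := by
  intro ν h ν' h' hidle
  have hd : ν.2.2 = ν'.2.2 := by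
    funext i
    by_cases hi : G.Adj t i
    · rw [← (eq_of_honestState_ne_zero h i).2.1 hi, ← (eq_of_honestState_ne_zero h' i).2.1 hi]
    · simpa [idlePads, hi] using congrFun hidle i
  have hr : ∀ i, ν.2.1 i = ν'.2.1 i := by
    intro i
    -- Induction in measurement order: once the earlier outcome pads agree, the angle of `i` agrees,
    -- and the `Z`-value of `i` reveals `r_i`.
    induction i using WellFoundedLT.induction with
    | ind i ih =>
      by_cases hi : G.Adj t i
      · simpa [idlePads, hi] using congrFun hidle i
      · have e := (eq_of_honestState_ne_zero h i).2.2 hi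
        rw [(eq_of_honestState_ne_zero h' i).2.2 hi,
          phi_congr b hd (fun j hj _ => ih j hj)] at e
        linear_combination -e
  -- With `d` and `r` known, all angles are known, and subtracting them from the settings leaves
  -- `θ`.
  have hθ : ν.1 = ν'.1 := by
    funext i
    have e := (eq_of_honestState_ne_zero h i).1
    rw [(eq_of_honestState_ne_zero h' i).1.1, (eq_of_honestState_ne_zero h' i).1.2] at e
    simp only [delta, phi_congr b hd (fun j _ _ => hr j), hr i] at e
    refine Prod.ext ?_ ?_
    · linear_combination -e.1
    · linear_combination -e.2
  exact Prod.ext hθ (Prod.ext (funext hr) hd)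

lemma card_pads : (Fintype.card (Pads V) : ℝ) = 16 ^ Fintype.card V := by
  simp only [Fintype.card_prod, Fintype.card_fun, ZMod.card]
  push_cast
  rw [← mul_pow, ← mul_pow]
  norm_num

/-- In a fixed branch, averaging over the pads leaves at most the uniform distribution. -/
lemma sum_honestState_le (C : Pattern G t) (b : Branch C)
    (p : (V → Ontic) × (V → Ontic × Ontic)) :
    ∑ ν : Pads V, honestState C ν b p ≤ (1 / 4) ^ Fintype.card V := by
  classical
  have hcard : (Finset.univ.filter fun ν : Pads V => honestState C ν b p ≠ 0).card ≤
      2 ^ Fintype.card V := by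
    calc _ ≤ (Finset.univ : Finset (V → Bit)).card :=
          Finset.card_le_card_of_injOn (idlePads G t) (fun _ _ => Finset.mem_univ _)
            (by simpa using idlePads_injOn C b p)
      _ = _ := by simp [ZMod.card]
  calc ∑ ν : Pads V, honestState C ν b p
      = ∑ ν : Pads V with honestState C ν b p ≠ 0, honestState C ν b p :=
        (Finset.sum_filter_ne_zero _).symm
    _ ≤ (Finset.univ.filter fun ν : Pads V => honestState C ν b p ≠ 0).card •
          (1 / 8 : ℝ) ^ Fintype.card V := Finset.sum_le_card_nsmul _ _ _ fun ν _ =>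
        honestState_le C ν b p
    -- At most one pad per value of the `n` idle bits contributes.
    _ ≤ 2 ^ Fintype.card V * (1 / 8) ^ Fintype.card V := by
        rw [nsmul_eq_mul]
        gcongr
        exact_mod_cast hcard
    _ = _ := by rw [← mul_pow]; norm_num

/-! ## The output state -/

/-- The ontic state of the outputs and the trap after the correction of branch `b`. -/
def final (C : Pattern G t) (ν : Pads V) (b : Branch C) (ω : All V B) : Final C :=
  fun i => (correct C ν b ω).1 i

/-- The branch that is read off from an ontic state. -/
def branchOf (C : Pattern G t) (ω : All V B) : Branch C := fun i => (ω.1 i).2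

/-- The classical output that is read off from an ontic state. -/
def outcomes (C : Pattern G t) (κ : Final C) : {i // i ∈ C.outputs} → Bit :=
  fun i => (κ ⟨i, Finset.mem_insert_of_mem i.2⟩).2

lemma projBranch_eq (C : Pattern G t) (b : Branch C) (ω : All V B) :
    projBranch C b ω = if b = branchOf C ω then 1 else 0 := by
  simp only [projBranch, projZ_eq, Finset.prod_ite_zero, Finset.prod_const_one, Finset.mem_univ,
    true_implies, funext_iff, branchOf, eq_comm]

variable [Fintype B] [DecidableEq B]

lemma sum_mul_traceTo (S : Finset V) (f : ({i // i ∈ S} → Ontic) → ℝ) (σ : All V B → ℝ) :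
    ∑ κ, f κ * traceTo S σ κ = ∑ ω, f (fun i => ω.1 i) * σ ω := by
  simp only [traceTo, Finset.mul_sum]
  rw [Finset.sum_comm]
  simp

lemma sum_mul_act {α : Type*} [Fintype α] (U : α ≃ α) (f ρ : α → ℝ) :
    ∑ a, f a * act U ρ a = ∑ a, f (U a) * ρ a := by
  rw [← Equiv.sum_comp U]
  simp [act]

/-- Expectation values in the output state, as sums over the ontic states before the deviation. -/
lemma sum_mul_rhoOut (C : Pattern G t) (ν : Pads V) (ξ : (B → Ontic) → ℝ)
    (Ω : All V B ≃ All V B) (f : Final C → ℝ) :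
    ∑ κ, f κ * rhoOut C ν ξ Ω κ = ∑ b : Branch C, ∑ ω : All V B,
      f (final C ν b (Ω ω)) * projBranch C b (Ω ω) *
        (honestState C ν b (ω.1, ω.2.1) * ξ ω.2.2) := by
  simp only [rhoOut, Finset.mul_sum]
  rw [Finset.sum_comm]
  refine Finset.sum_congr rfl fun b _ => ?_
  rw [sum_mul_traceTo, sum_mul_act (correct C ν b) (fun ω : All V B => f fun i => ω.1 i)]
  simp only [← mul_assoc]
  exact (sum_mul_act Ω (fun ω : All V B => f (final C ν b ω) * projBranch C b ω) _).trans
    (by simp only [mul_assoc]; rfl)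

lemma projOutputs_eq (C : Pattern G t) (a : {i // i ∈ C.outputs} → Bit) (κ : Final C) :
    projOutputs C a κ = if a = outcomes C κ then 1 else 0 := by
  simp only [projOutputs, projZ_eq, Finset.prod_ite_zero, Finset.prod_const_one, Finset.mem_univ,
    true_implies, funext_iff, outcomes, eq_comm]

-- The outcome projectors have disjoint supports, so only the string read off from `κ` can
-- contribute.
open Classical in
lemma projHonest_eq (C : Pattern G t) (ν : Pads V) (ξ : (B → Ontic) → ℝ) (κ : Final C) :
    projHonest C ν ξ κ = if ∑ κ₀, projOutputs C (outcomes C κ) κ₀ *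
      rhoHonest C ν ξ κ₀ ≠ 0 then 1 else 0 := by
  unfold projHonest
  rw [Finset.sum_eq_single (outcomes C κ)]
  · simp only [projOutputs_eq C _ κ, if_true]
  · intro a _ ha
    rw [projOutputs_eq C a κ, if_neg ha, ite_self]
  · exact fun h => absurd (Finset.mem_univ _) h

/-- A possible run before the deviation gives an honest output. -/
lemma projHonest_final_eq_one {C : Pattern G t} {ν : Pads V} {ξ : (B → Ontic) → ℝ}
    (hξ : ∀ β, 0 ≤ ξ β) {b : Branch C} {ω ω' : All V B}
    (h : honestState C ν b (ω.1, ω.2.1) * ξ ω.2.2 ≠ 0) (hb : b = branchOf C ω')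
    (hω : ∀ i, (ω'.1 i).2 = (ω.1 i).2) : projHonest C ν ξ (final C ν b ω') = 1 := by
  rw [projHonest_eq, if_pos]
  refine ne_of_gt ?_
  rw [rhoHonest, sum_mul_rhoOut]
  have hnn : ∀ (a : {i // i ∈ C.outputs} → Bit) (b : Branch C) (ω : All V B),
      0 ≤ projOutputs C a (final C ν b (Equiv.refl _ ω)) * projBranch C b (Equiv.refl _ ω) *
        (honestState C ν b (ω.1, ω.2.1) * ξ ω.2.2) := by
    intro a b ω
    have h1 := mul_nonneg (honestState_nonneg C ν b (ω.1, ω.2.1)) (hξ ω.2.2)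
    rw [projOutputs_eq, projBranch_eq]
    split_ifs <;> simp [h1]
  -- The honest run itself contains `ω` in branch `b`. Equal `Z`-values and the same corrections
  -- give the same output, so this term is positive.
  refine Finset.sum_pos' (fun b _ => Finset.sum_nonneg fun ω _ => hnn _ b ω)
    ⟨b, Finset.mem_univ _, Finset.sum_pos' (fun ω _ => hnn _ b ω) ⟨ω, Finset.mem_univ _, ?_⟩⟩
  rw [projOutputs_eq, projBranch_eq, if_pos, if_pos]
  · simpa using lt_of_le_of_ne (mul_nonneg (honestState_nonneg C ν b _) (hξ _)) h.symm
  · exact hb.trans (funext fun i => hω i)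
  · funext i
    simp [outcomes, final, correct, hω]

/-- On the support of the state before the deviation, the trap has its correct value. -/
lemma trap_eq_of_honestState_ne_zero {C : Pattern G t} {ν : Pads V} {b : Branch C}
    {p : (V → Ontic) × (V → Ontic × Ontic)} (h : honestState C ν b p ≠ 0) :
    (p.1 t).2 = ν.2.1 t + dummyShift G t ν t := by
  have ht : t ∉ comp G t := fun h => (Finset.mem_filter.1 h).2.1 rfl
  rw [(eq_of_honestState_ne_zero h t).2.2 (G.loopless.irrefl t)]
  simp only [phi, notMem_outputs C, ht, if_false, zero_mul, zero_add, dummyShift,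
    Finset.inter_self]
  congr 1
  refine Finset.sum_congr rfl fun j hj => ?_
  exact (eq_of_honestState_ne_zero h j).2.1 ((G.mem_neighborFinset t j).1 hj)

/-- Removes the honest output and the trap pads from the estimate: the event on the right depends on
`Ω`, `ω` and `t` only, so the pads can be averaged at fixed `ω`. -/
lemma fail_le (C : Pattern G t) (ν : Pads V) {ξ : (B → Ontic) → ℝ} (hξ : ∀ β, 0 ≤ ξ β)
    (Ω : All V B ≃ All V B) :
    ∑ κ, (1 - projHonest C ν ξ κ) * projTrap C ν κ * rhoOut C ν ξ Ω κ ≤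
      ∑ ω : All V B, if Undetected Ω ω t then
        honestState C ν (branchOf C (Ω ω)) (ω.1, ω.2.1) * ξ ω.2.2 else 0 := by
  rw [sum_mul_rhoOut C ν ξ Ω (fun κ => (1 - projHonest C ν ξ κ) * projTrap C ν κ),
    Finset.sum_comm]
  refine Finset.sum_le_sum fun ω _ => ?_
  -- The reported outcomes are a function of `Ω ω`, so each `ω` survives in exactly one branch, the
  -- same for all pads.
  rw [Finset.sum_eq_single (branchOf C (Ω ω))]
  · rw [projBranch_eq, if_pos rfl, mul_one]
    set b := branchOf C (Ω ω) with hb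
    by_cases h0 : honestState C ν b (ω.1, ω.2.1) * ξ ω.2.2 = 0
    · simp [h0]
    have hw := mul_nonneg (honestState_nonneg C ν b (ω.1, ω.2.1)) (hξ ω.2.2)
    have htrap : projTrap C ν (final C ν b (Ω ω)) =
        if ((Ω ω).1 t).2 = (ω.1 t).2 then 1 else 0 := by
      rw [trap_eq_of_honestState_ne_zero (left_ne_zero_of_mul h0), projTrap, projZ_eq]
      simp [final, correct, outputFlip, notMem_outputs C]
    rw [htrap]
    by_cases he : ∀ i, ((Ω ω).1 i).2 = (ω.1 i).2
    · rw [projHonest_final_eq_one hξ h0 hb he, if_neg (show ¬ Undetected Ω ω t from fun h => h.2.elim fun i hi => hi (he i))]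
      simp
    · push Not at he
      rw [projHonest_eq]
      by_cases ht : ((Ω ω).1 t).2 = (ω.1 t).2
      · rw [if_pos ht, if_pos (show Undetected Ω ω t from ⟨ht, he⟩)]
        split_ifs <;> simp [hw]
      · rw [if_neg ht, if_neg (show ¬ Undetected Ω ω t from fun h => ht h.1)]
        simp
  · intro b _ hb
    rw [projBranch_eq, if_neg hb]
    simp
  · exact fun h => absurd (Finset.mem_univ _) h

/-! ### Averaging over pads and trap positions -/

lemma sum_all (ξ : (B → Ontic) → ℝ) :
    ∑ ω : All V B, ξ ω.2.2 = 64 ^ Fintype.card V * ∑ β, ξ β := by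
  simp only [Fintype.sum_prod_type, Finset.sum_const, Finset.card_univ, nsmul_eq_mul,
    Fintype.card_prod, Fintype.card_fun, ZMod.card]
  push_cast
  rw [← mul_assoc, ← mul_pow]
  norm_num

/-- The probability of failure is at most `1 - 1 / n`. -/
theorem pFail_le [Nonempty V] (C : ∀ t, Pattern G t) {ξ : (B → Ontic) → ℝ}
    (hξ : ∀ β, 0 ≤ ξ β) (hξ_sum : ∑ β, ξ β = 1) (Ω : All V B ≃ All V B) :
    pFail G C ξ Ω ≤ 1 - 1 / (Fintype.card V : ℝ) := by
  have hn : (0 : ℝ) < Fintype.card V := by exact_mod_cast Fintype.card_pos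
  set c : ℝ := 1 / (Fintype.card V * Fintype.card (Pads V) : ℝ) with hc
  have hc0 : 0 ≤ c := by positivity
  calc pFail G C ξ Ω
      ≤ ∑ t : V, ∑ ν : Pads V, c * ∑ ω : All V B, if Undetected Ω ω t then
          honestState (C t) ν (branchOf (C t) (Ω ω)) (ω.1, ω.2.1) * ξ ω.2.2 else 0 :=
        Finset.sum_le_sum fun t _ => Finset.sum_le_sum fun ν _ =>
          mul_le_mul_of_nonneg_left (fail_le (C t) ν hξ Ω) hc0
    _ = ∑ t : V, ∑ ω : All V B, if Undetected Ω ω t then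
          c * ξ ω.2.2 * ∑ ν : Pads V,
            honestState (C t) ν (branchOf (C t) (Ω ω)) (ω.1, ω.2.1) else 0 := by
        refine Finset.sum_congr rfl fun t _ => ?_
        simp only [Finset.mul_sum]
        rw [Finset.sum_comm]
        refine Finset.sum_congr rfl fun ω _ => ?_
        split_ifs
        · exact Finset.sum_congr rfl fun ν _ => by ring
        · simp
    -- Blindness replaces the weight of `ω` by one that depends on neither `t` nor the branch, so
    -- the trap positions can then be counted for each `ω`.
    _ ≤ ∑ t : V, ∑ ω : All V B, if Undetected Ω ω t then
          c * ξ ω.2.2 * (1 / 4) ^ Fintype.card V else 0 := by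
        refine Finset.sum_le_sum fun t _ => Finset.sum_le_sum fun ω _ => ?_
        split_ifs
        · exact mul_le_mul_of_nonneg_left (sum_honestState_le _ _ _) (mul_nonneg hc0 (hξ _))
        · exact le_rfl
    _ = ∑ ω : All V B, (Finset.univ.filter (Undetected Ω ω)).card *
          (c * ξ ω.2.2 * (1 / 4) ^ Fintype.card V) := by
        rw [Finset.sum_comm]
        refine Finset.sum_congr rfl fun ω _ => ?_
        rw [← Finset.sum_filter, Finset.sum_const, nsmul_eq_mul]
    _ ≤ ∑ ω : All V B, (Fintype.card V - 1 : ℝ) *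
          (c * ξ ω.2.2 * (1 / 4) ^ Fintype.card V) := by
        refine Finset.sum_le_sum fun ω _ => ?_
        have := hξ ω.2.2
        exact mul_le_mul_of_nonneg_right (card_undetected_le Ω ω) (by positivity)
    _ = (Fintype.card V - 1) * (c * (1 / 4) ^ Fintype.card V) * ∑ ω : All V B, ξ ω.2.2 := by
        rw [Finset.mul_sum]
        exact Finset.sum_congr rfl fun ω _ => by ring
    -- The powers cancel, `64ⁿ = 4ⁿ * 16ⁿ`, leaving `(n - 1) / n`.
    _ = 1 - 1 / (Fintype.card V : ℝ) := by
        rw [sum_all, hξ_sum, hc, card_pads]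
        have : (64 : ℝ) ^ Fintype.card V = 4 ^ Fintype.card V * 16 ^ Fintype.card V := by
          rw [← mul_pow]; norm_num
        rw [this, one_div_pow]
        field_simp

end Protocol

end ToyFK

/-- The bound holds for every permutation `Ω` of the ontic states of all systems, in particular for
every toy transformation, and for every initial ontic distribution `ξ` of Bob's private systems,
in particular for every toy state. -/
theorem theorem9 {V : Type*} [Fintype V] [LinearOrder V] [Nonempty V]
    (G : SimpleGraph V) [DecidableRel G.Adj] (C : ∀ t, ToyFK.Pattern G t)
    {B : Type*} [Fintype B] [DecidableEq B]
    (ξ : (B → ToyFK.Ontic) → ℝ) (hξ_nonneg : ∀ β, 0 ≤ ξ β) (hξ_sum : ∑ β, ξ β = 1)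
    (Ω : ToyFK.All V B ≃ ToyFK.All V B) :
    ToyFK.pFail G C ξ Ω ≤ 1 - 1 / (2 * (Fintype.card V : ℝ)) := by
  have hn : (0 : ℝ) < Fintype.card V := by exact_mod_cast Fintype.card_pos
  refine (ToyFK.pFail_le C hξ_nonneg hξ_sum Ω).trans (sub_le_sub_left ?_ 1)
  exact one_div_le_one_div_of_le hn (by linarith)
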